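/- Theorem (bounded priority-free regret of OM-LEX when the lexicographic optimal expected rewards are known). Consider a multiobjective multi-armed bandit with finitely many arms $\mathcal A=\{1,\dots,A\}$, $A\ge 1$, and objectives $\mathcal D=\{1,\dots,D\}$. In each round $t=1,2,\dots$ the learner selects an arm $a(t)$ and observes the rewards $r^i(t)=\mu^i_{a(t)}+\kappa^i(t)$, $i\in\mathcal D$. Given the past and $a(t)=a$, the noise vector $(\kappa^1(t),\dots,\kappa^D(t))$ is drawn from a fixed distribution $\nu_a$ on $\mathbb R^D$ whose marginals have mean zero and are $1$-sub-Gaussian, i.e. $\mathbb E[e^{\lambda\kappa^i(t)}\mid a(t)=a]\le e^{\lambda^2/2}$ for all $\lambda\in\mathbb R$. A vector $x\in\mathbb R^D$ lexicographically dominates $y\in\mathbb R^D$ if $x\ne y$ and $x^j>y^j$ for the smallest $j$ with $x^j\neq y^j$. Let $*$ be a lexicographic optimal arm, i.e. one whose vector of expected rewards $(\mu_*^1,\dots,\mu_*^D)$ is not dominated by that of any other arm. Put $\Delta_a^i=\mu_*^i-\mu_a^i$, $\nabla_a^{\max}=\max_{j\in\mathcal D}|\Delta_a^j|$ and $\mathcal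 S^i=\{a\in\mathcal A:\Delta_a^i>0\}$. The learner knows $\mu_*^1,\dots,\mu_*^D$ and runs the algorithm OM-LEX. Let $N_a$ be the number of times that arm $a$ has been selected so far and $\hat\mu_a^i$ the sample mean of the rewards of arm $a$ in objective $i$ observed so far. In rounds $1,\dots,A$, OM-LEX selects the arms $1,\dots,A$ in this order. After that it repeats the following step: let $\hat{\mathcal A}_*=\{a\in\mathcal A:\ |\hat\mu_a^i-\mu_*^i|<\sqrt{4\log N_a/N_a}\ \text{ for all } i\in\mathcal D\}$; if $\hat{\mathcal A}_*\ne\emptyset$, select one arm of $\hat{\mathcal A}_*$ uniformly at random; if $\hat{\mathcal A}_*=\emptyset$, select the arms $1,\dots,A$ in this order in the next $A$ rounds. Then for every $i\in\mathcal D$ and every $T\ge 1$ the priority-free regret $\mathrm{Reg}^i_{pf}(T)=\sum_{t=1}^T\Delta^i_{a(t)}$ satisfies $$\mathbb E\big[\mathrm{Reg}^i_{pf}(T)\big]\ \le\ \sum_{a\in\mathcal S^i}\left(\Big(\frac{\pi^2}{3}D+1\Big)\Delta_a^i+\frac{36}{\nabla_a^{\max}}\,\log^+\frac{17}{\nabla_a^{\max}}\right),$$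 where $\log^+x=\max\{\log x,0\}$ (so that $\log^+(17/\nabla_a^{\max})=\log(17/\nabla_a^{\max})$ whenever $\nabla_a^{\max}\le 17$). The bound does not depend on $T$. -/

import Mathlib

open MeasureTheory ProbabilityTheory Finset

/-! Multiobjective multi-armed bandits with lexicographically ordered objectives.

There are `A` arms and `D` objectives; `μ a i` is the expected reward of arm `a` in objective `i`.
Arms, objectives and rounds are numbered from `0`: round `t` here is round `t + 1` when rounds are
numbered `1, 2, …`. -/

namespace LexBandit

/-- `x` lexicographically dominates `y` in the first `k` objectives: among these, `x` is larger
than `y` in the first objective in which they differ. -/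
def LexDominates {D : ℕ} (k : ℕ) (x y : Fin D → ℝ) : Prop :=
  ∃ j : Fin D, (j : ℕ) < k ∧ (∀ l < j, x l = y l) ∧ y j < x j

/-- The arms that are lexicographic optimal in the first `k` objectives. -/
def lexOptimal {A D : ℕ} (μ : Fin A → Fin D → ℝ) (k : ℕ) : Set (Fin A) :=
  {a | ∀ a', ¬ LexDominates k (μ a') (μ a)}

/-- The gap of arm `a` in objective `i`, relative to the lexicographic optimal arm `star`. -/
def gap {A D : ℕ} (μ : Fin A → Fin D → ℝ) (star a : Fin A) (i : Fin D) : ℝ :=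
  μ star i - μ a i

/-- The maximum absolute gap of arm `a` over all objectives. -/
noncomputable def maxAbsGap {A D : ℕ} (μ : Fin A → Fin D → ℝ) (star a : Fin A) : ℝ :=
  ⨆ j : Fin D, |gap μ star a j|

open Classical in
/-- The arms that are suboptimal in objective `i`, i.e. that have a positive gap in it. -/
noncomputable def suboptimal {A D : ℕ} (μ : Fin A → Fin D → ℝ) (star : Fin A) (i : Fin D) :
    Finset (Fin A) :=
  {a | 0 < gap μ star a i}

/-- Priority-free regret in objective `i` after the first `T` rounds, if `x t` is the arm selected
in round `t`. -/
noncomputable def regretPF {A D : ℕ} (μ : Fin A → Fin D → ℝ) (star : Fin A) (i : Fin D)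
    (x : ℕ → Fin A) (T : ℕ) : ℝ :=
  ∑ t ∈ range T, gap μ star (x t) i

/-! ### The algorithm OM-LEX

It is described on a sequence `x` of selected arms and a sequence `r` of observed reward vectors.
All quantities at time `t` depend only on the entries with index less than `t`. -/

/-- The number of times that arm `a` was selected before round `t`. -/
def pulls {A : ℕ} (x : ℕ → Fin A) (a : Fin A) (t : ℕ) : ℕ :=
  #{s ∈ range t | x s = a}

/-- The sample mean of the rewards of arm `a` in objective `i` observed before round `t`. -/
noncomputable def sampleMean {A D : ℕ} (x : ℕ → Fin A) (r : ℕ → Fin D → ℝ) (a : Fin A)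
    (i : Fin D) (t : ℕ) : ℝ :=
  (∑ s ∈ range t with x s = a, r s i) / pulls x a t

open Classical in
/-- The estimated lexicographic optimal arms at the beginning of round `t`, when `m i` is given to
the learner as the lexicographic optimal expected reward in objective `i`. -/
noncomputable def estimatedOptimal {A D : ℕ} (m : Fin D → ℝ) (x : ℕ → Fin A)
    (r : ℕ → Fin D → ℝ) (t : ℕ) : Finset (Fin A) :=
  {a | ∀ i, |sampleMean x r a i t - m i| <
    Real.sqrt (4 * Real.log (pulls x a t) / pulls x a t)}

/-- What happens if the algorithm is free to decide in round `t`: `none` means that it exploits in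
this round, `some 0` that it starts to play all arms once, beginning with the first one. -/
noncomputable def decision {A D : ℕ} [NeZero A] (m : Fin D → ℝ) (x : ℕ → Fin A)
    (r : ℕ → Fin D → ℝ) (t : ℕ) : Option (Fin A) :=
  if (estimatedOptimal m x r t).Nonempty then none else some 0

/-- `some k` if round `t` belongs to a pass through all arms (the initial one or one started
because there were no estimated optimal arms) in which it is the turn of arm `k`; `none` if the
algorithm exploits in round `t`. A pass that has been started is always completed. -/
noncomputable def turn {A D : ℕ} [NeZero A] (m : Fin D → ℝ) (x : ℕ → Fin A)
    (r : ℕ → Fin D → ℝ) : ℕ → Option (Fin A)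
  | 0 => some 0
  | t + 1 =>
    match turn m x r t with
    | some k => if h : (k : ℕ) + 1 < A then some ⟨k + 1, h⟩ else decision m x r (t + 1)
    | none => decision m x r (t + 1)

/-- The set from which OM-LEX selects the arm of round `t` uniformly at random: a single arm during
a pass through all arms, and all estimated optimal arms when it exploits. -/
noncomputable def choices {A D : ℕ} [NeZero A] (m : Fin D → ℝ) (x : ℕ → Fin A)
    (r : ℕ → Fin D → ℝ) (t : ℕ) : Finset (Fin A) :=
  match turn m x r t with
  | some k => {k}
  | none => estimatedOptimal m x r t

/-! ### The random process -/

/-- The reward vector observed in round `t`: the expected rewards of the selected arm plus noise. -/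
def reward {A D : ℕ} {Ω : Type*} (μ : Fin A → Fin D → ℝ) (act : ℕ → Ω → Fin A)
    (noise : ℕ → Ω → Fin D → ℝ) (ω : Ω) (t : ℕ) : Fin D → ℝ :=
  fun i => μ (act t ω) i + noise t ω i

/-- The σ-algebra generated by the arms and the noise vectors (equivalently, by the arms and the
reward vectors) of the rounds before `t`. -/
abbrev past {A D : ℕ} {Ω : Type*} (act : ℕ → Ω → Fin A) (noise : ℕ → Ω → Fin D → ℝ) (t : ℕ) :
    MeasurableSpace Ω :=
  ⨆ s : ℕ, ⨆ _ : s < t, MeasurableSpace.comap (fun ω => (act s ω, noise s ω)) inferInstance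

/-- The processes `act` (selected arms) and `noise` on the probability space `(Ω, P)` arise from
running OM-LEX with input `m` on the bandit with expected rewards `μ` and noise distributions `ν`.
Given the past, the arm of round `t` is uniformly distributed on the set prescribed by the
algorithm; given the past and that this arm is `a`, the noise vector has distribution `ν a`. -/
structure IsRunOMLEX {A D : ℕ} [NeZero A] {Ω : Type*} [MeasurableSpace Ω] (P : Measure Ω)
    (μ : Fin A → Fin D → ℝ) (ν : Fin A → Measure (Fin D → ℝ)) (m : Fin D → ℝ)
    (act : ℕ → Ω → Fin A) (noise : ℕ → Ω → Fin D → ℝ) : Prop where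
  measurable_act : ∀ t, Measurable (act t)
  measurable_noise : ∀ t, Measurable (noise t)
  act_law : ∀ (t : ℕ) (b : Fin A),
    P⟦act t ⁻¹' {b} | past act noise t⟧ =ᵐ[P] fun ω =>
      if b ∈ choices m (fun s => act s ω) (reward μ act noise ω) t then
        ((#(choices m (fun s => act s ω) (reward μ act noise ω) t) : ℝ))⁻¹
      else 0
  noise_law : ∀ (t : ℕ) (C : Set (Fin D → ℝ)), MeasurableSet C →
    P⟦noise t ⁻¹' C | past act noise t ⊔ MeasurableSpace.comap (act t) inferInstance⟧ =ᵐ[P]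
      fun ω => (ν (act t ω)).real C

end LexBandit

/-! An arm `a` is selected either during a pass through all arms or because it is estimated to be
optimal, and both kinds of selections are charged to deviations of sample means. Passes: every pass
after the first starts when `star` fails its own confidence test. Since each pass pulls `star`,
these failures occur at different pull counts `n`. At `n = 1` the radius is zero and the test always
fails. For `n ≥ 2` a failure needs a deviation of at least `√(4 log n / n)` in some objective, which
has probability at most `2 D / n ^ 2`. Exploitation: let `d` be the largest absolute gap of `a`.
Once `n` exceeds about `36 / d ^ 2 * log (17 / d)`, the radius is at most `2 d / 3`. Passing the
test then forces the noise mean of `a` to deviate by `d / 3` in a known direction, and the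
probabilities `exp (-n d ^ 2 / 18)` of this sum to at most 1 (`pulls_le_card_add_card`,
`pulls_le_sum_indicator`). The round in which an arm reaches its `n`-th pull is random. The tail
bounds therefore come from an exponential supermartingale that only collects the first `n` pulls and
is frozen afterwards. Markov's inequality at the fixed horizon `T` covers all rounds with pull count
`n` at once (`IsRunOMLEX.lintegral_exp_expExponent_le_one`, `IsRunOMLEX.measureReal_deviation_le`).
-/

namespace LexBandit

/-! ### Counting selections and passes along a fixed trajectory -/

section Deterministic

variable {A D : ℕ}

theorem pulls_zero (x : ℕ → Fin A) (a : Fin A) : pulls x a 0 = 0 := by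
  simp [pulls]

theorem pulls_succ (x : ℕ → Fin A) (a : Fin A) (t : ℕ) :
    pulls x a (t + 1) = pulls x a t + if x t = a then 1 else 0 := by
  simp only [pulls, Finset.card_filter, Finset.sum_range_succ]

theorem pulls_mono (x : ℕ → Fin A) (a : Fin A) : Monotone (pulls x a) :=
  monotone_nat_of_le_succ fun t => by rw [pulls_succ]; omega

theorem pulls_lt_of_lt {x : ℕ → Fin A} {a : Fin A} {s t : ℕ} (hst : s < t) (hs : x s = a) :
    pulls x a s < pulls x a t := by
  have h := pulls_mono x a (Nat.succ_le_of_lt hst)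
  rw [Nat.succ_eq_add_one, pulls_succ, if_pos hs] at h
  omega

theorem pulls_le (x : ℕ → Fin A) (a : Fin A) (t : ℕ) : pulls x a t ≤ t :=
  (Finset.card_filter_le _ _).trans (Finset.card_range t).le

theorem filter_pulls_lt {x : ℕ → Fin A} {a : Fin A} {t T : ℕ} (h : t ≤ T) :
    {s ∈ range T | x s = a ∧ pulls x a s < pulls x a t} = {s ∈ range t | x s = a} := by
  ext s
  simp only [mem_filter, mem_range]
  constructor
  · rintro ⟨_, hs, hp⟩
    exact ⟨lt_of_not_ge fun hts => hp.not_ge (pulls_mono x a hts), hs⟩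
  · rintro ⟨hst, hs⟩
    exact ⟨hst.trans_le h, hs, pulls_lt_of_lt hst hs⟩

/-- The exponent of the exponential supermartingale with parameter `l` that belongs to the noise in
objective `j` of the first `n` rewards of arm `a`. -/
noncomputable def expExponent (x : ℕ → Fin A) (v : ℕ → Fin D → ℝ) (a : Fin A) (j : Fin D) (n : ℕ)
    (l : ℝ) (t : ℕ) : ℝ :=
  ∑ s ∈ range t with x s = a ∧ pulls x a s < n, (l * v s j - l ^ 2 / 2)

theorem expExponent_succ (x : ℕ → Fin A) (v : ℕ → Fin D → ℝ) (a : Fin A) (j : Fin D) (n : ℕ)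
    (l : ℝ) (t : ℕ) :
    expExponent x v a j n l (t + 1) = expExponent x v a j n l t +
      if x t = a ∧ pulls x a t < n then l * v t j - l ^ 2 / 2 else 0 := by
  simp only [expExponent, Finset.sum_filter, Finset.sum_range_succ]

/-- After round `t` every pull of `a` has index at least `pulls x a t`, so nothing more is added.
The value at the horizon `T` thus still records the noise sum at round `t`. -/
theorem expExponent_pulls (x : ℕ → Fin A) (v : ℕ → Fin D → ℝ) (a : Fin A) (j : Fin D)
    (l : ℝ) {t T : ℕ} (h : t ≤ T) :
    expExponent x v a j (pulls x a t) l T =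
      l * (∑ s ∈ range t with x s = a, v s j) - pulls x a t * (l ^ 2 / 2) := by
  rw [expExponent, filter_pulls_lt h, Finset.sum_sub_distrib, Finset.mul_sum, Finset.sum_const,
    nsmul_eq_mul, pulls]

theorem sampleMean_add (x : ℕ → Fin A) (μ : Fin A → Fin D → ℝ) (v : ℕ → Fin D → ℝ) (a : Fin A)
    (j : Fin D) {t : ℕ} (h : 0 < pulls x a t) :
    sampleMean x (fun s i => μ (x s) i + v s i) a j t =
      μ a j + (∑ s ∈ range t with x s = a, v s j) / pulls x a t := by
  have h' : (pulls x a t : ℝ) ≠ 0 := by positivity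
  have : ∑ s ∈ range t with x s = a, (μ (x s) j + v s j) =
      pulls x a t * μ a j + ∑ s ∈ range t with x s = a, v s j := by
    rw [Finset.sum_add_distrib]
    congr 1
    rw [Finset.sum_congr rfl (g := fun _ => μ a j) fun s hs => by rw [(mem_filter.1 hs).2],
      Finset.sum_const, nsmul_eq_mul, pulls]
  rw [sampleMean, this]
  field_simp

variable [NeZero A]

theorem turn_succ_cases {m : Fin D → ℝ} {x : ℕ → Fin A} {r : ℕ → Fin D → ℝ} {t : ℕ} {k : Fin A}
    (h : turn m x r (t + 1) = some k) :
    (∃ k' : Fin A, turn m x r t = some k' ∧ (k : ℕ) = k' + 1) ∨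
      (k = 0 ∧ ¬ (estimatedOptimal m x r (t + 1)).Nonempty) := by
  have hdec : decision m x r (t + 1) = some k →
      k = 0 ∧ ¬ (estimatedOptimal m x r (t + 1)).Nonempty := by
    intro hd
    unfold decision at hd
    split_ifs at hd with he
    exact ⟨(Option.some.inj hd).symm, he⟩
  rw [turn] at h
  split at h
  · next k' hk' =>
    split_ifs at h with hlt
    · exact .inl ⟨k', hk', by rw [← Option.some.inj h]⟩
    · exact .inr (hdec h)
  · exact .inr (hdec h)

theorem turn_sub {m : Fin D → ℝ} {x : ℕ → Fin A} {r : ℕ → Fin D → ℝ} :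
    ∀ {t : ℕ} {k : Fin A}, turn m x r t = some k → (k : ℕ) ≤ t ∧ turn m x r (t - k) = some 0
  | 0, k, h => by
    rw [turn] at h
    obtain rfl := Option.some.inj h
    simp [turn]
  | t + 1, k, h => by
    obtain ⟨k', hk', e⟩ | ⟨rfl, -⟩ := turn_succ_cases h
    · obtain ⟨h1, h2⟩ := turn_sub hk'
      rw [e, Nat.add_sub_add_right]
      exact ⟨by omega, h2⟩
    · simpa using h

theorem turn_add {m : Fin D → ℝ} {x : ℕ → Fin A} {r : ℕ → Fin D → ℝ} {t : ℕ}
    (h : turn m x r t = some 0) : ∀ {k : ℕ} (hk : k < A), turn m x r (t + k) = some ⟨k, hk⟩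
  | 0, hk => by rw [Nat.add_zero, h]; rfl
  | k + 1, hk => by
    have := turn_add h (Nat.lt_of_succ_lt hk)
    rw [← Nat.add_assoc, turn, this]
    simp [hk]

/-- Between two starts of a pass, every arm is selected. -/
theorem pulls_lt_of_turn_zero {m : Fin D → ℝ} {x : ℕ → Fin A} {r : ℕ → Fin D → ℝ} {T : ℕ}
    (hx : ∀ t < T, x t ∈ choices m x r t) (a : Fin A) {t t' : ℕ} (ht : turn m x r t = some 0)
    (ht' : turn m x r t' = some 0) (hlt : t < t') (hT : t' < T) :
    pulls x a t < pulls x a t' := by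
  -- A start at `t + k + 1` with `k + 1 < A` would fall inside the pass begun at `t`, where it is
  -- the turn of arm `k + 1`, not of arm `0`.
  have hle : t + A ≤ t' := by
    by_contra hcon
    obtain ⟨k, rfl⟩ := Nat.exists_eq_add_of_lt hlt
    have := turn_add ht (k := k + 1) (by omega)
    rw [← Nat.add_assoc, ht', Option.some.injEq, Fin.ext_iff] at this
    simp at this
  have ha : x (t + a) = a := by
    have := hx (t + a) (by have := a.2; omega)
    rw [choices, turn_add ht a.2] at this
    simpa using this
  exact (pulls_mono x a (Nat.le_add_right t a)).trans_lt
    (pulls_lt_of_lt (by have := a.2; omega) ha)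

/-- The rounds in which arm `a` is selected in a pass are at most as many as the passes, and every
pass but the first one starts when the arm `b` is not estimated to be optimal. -/
theorem card_turn_le {m : Fin D → ℝ} {x : ℕ → Fin A} {r : ℕ → Fin D → ℝ} {T : ℕ}
    (hx : ∀ t < T, x t ∈ choices m x r t) (a b : Fin A) (S : Finset ℕ)
    (hS : ∀ t < T, 0 < pulls x b t → b ∉ estimatedOptimal m x r t → pulls x b t ∈ S) :
    #{t ∈ range T | turn m x r t = some a} ≤ 1 + #S := by
  calc #{t ∈ range T | turn m x r t = some a}
      ≤ #{t ∈ range T | turn m x r t = some 0} := by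
        -- Move each turn of `a` back to the start of its pass; the truncated subtraction is
        -- injective because `a ≤ t` there.
        refine Finset.card_le_card_of_injOn (fun t => t - a) ?_ ?_
        · intro t ht
          simp only [coe_filter, mem_range, Set.mem_ofPred_eq] at ht ⊢
          exact ⟨by omega, (turn_sub ht.2).2⟩
        · intro t ht t' ht' e
          simp only [coe_filter, mem_range, Set.mem_ofPred_eq] at ht ht' e
          have := (turn_sub ht.2).1
          have := (turn_sub ht'.2).1
          omega
    _ ≤ #(insert 0 S) := by
        -- Starts of passes are told apart by the pull count of `b`; the extra value `0` belongs to
        -- the initial pass.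
        refine Finset.card_le_card_of_injOn (fun t => pulls x b t) ?_ ?_
        · intro t ht
          simp only [coe_filter, mem_range, Set.mem_ofPred_eq] at ht
          cases t with
          | zero => simp [pulls_zero]
          | succ t =>
            refine Finset.mem_insert_of_mem (hS _ ht.1 ?_ ?_)
            · exact (Nat.zero_le _).trans_lt
                (pulls_lt_of_turn_zero hx b (by rw [turn]) ht.2 t.succ_pos ht.1)
            · obtain ⟨k', -, e⟩ | ⟨-, h⟩ := turn_succ_cases ht.2
              · simp at e
              · exact fun hb => h ⟨b, hb⟩
        · intro t ht t' ht' e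
          simp only [coe_filter, mem_range, Set.mem_ofPred_eq] at ht ht' e
          rcases lt_trichotomy t t' with h | h | h
          · exact absurd e (pulls_lt_of_turn_zero hx b ht.2 ht'.2 h ht'.1).ne
          · exact h
          · exact absurd e (pulls_lt_of_turn_zero hx b ht'.2 ht.2 h ht.1).ne'
    _ ≤ 1 + #S := by rw [add_comm]; exact Finset.card_insert_le _ _

/-- The rounds in which an arm is selected: in a pass, or because it is estimated to be optimal. -/
theorem pulls_le_card_add_card {m : Fin D → ℝ} {x : ℕ → Fin A} {r : ℕ → Fin D → ℝ} {T : ℕ}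
    (hx : ∀ t < T, x t ∈ choices m x r t) (a b : Fin A) (S S' : Finset ℕ)
    (hS : ∀ t < T, 0 < pulls x b t → b ∉ estimatedOptimal m x r t → pulls x b t ∈ S)
    (hS' : ∀ t < T, a ∈ estimatedOptimal m x r t → pulls x a t ∈ S') :
    pulls x a T ≤ 1 + #S + #S' := by
  have hsub : {t ∈ range T | x t = a} ⊆ {t ∈ range T | turn m x r t = some a} ∪
      {t ∈ range T | x t = a ∧ a ∈ estimatedOptimal m x r t} := by
    intro t ht
    simp only [mem_filter, mem_range, mem_union] at ht ⊢
    have hc := hx t ht.1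
    unfold choices at hc
    split at hc
    · next k hk =>
      obtain rfl : x t = k := by simpa using hc
      exact .inl ⟨ht.1, by rw [hk, ht.2]⟩
    · exact .inr ⟨ht.1, ht.2, ht.2 ▸ hc⟩
  refine (Finset.card_le_card hsub).trans ((Finset.card_union_le _ _).trans ?_)
  refine add_le_add (card_turn_le hx a b S hS)
    (Finset.card_le_card_of_injOn (fun t => pulls x a t) ?_ ?_)
  · intro t ht
    simp only [coe_filter, mem_range, Set.mem_ofPred_eq] at ht
    exact hS' t ht.1 ht.2.2
  · intro t ht t' ht' e
    simp only [coe_filter, mem_range, Set.mem_ofPred_eq] at ht ht' e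
    rcases lt_trichotomy t t' with h | h | h
    · exact absurd e (pulls_lt_of_lt h ht.2.1).ne
    · exact h
    · exact absurd e (pulls_lt_of_lt h ht'.2.1).ne'

end Deterministic

/-! ### The exponential supermartingale and its tail bound -/

section Probability

open scoped ENNReal

theorem measurable_pulls {A : ℕ} {Ω : Type*} [MeasurableSpace Ω] {act : ℕ → Ω → Fin A} {t : ℕ}
    (h : ∀ s < t, Measurable (act s)) (a : Fin A) :
    Measurable fun ω => pulls (fun s => act s ω) a t := by
  simp only [pulls, Finset.card_filter]
  refine Finset.measurable_sum _ fun s hs => Measurable.ite ?_ measurable_const measurable_const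
  exact h s (mem_range.1 hs) (measurableSet_singleton a)

theorem measurable_expExponent {A D : ℕ} {Ω : Type*} [MeasurableSpace Ω] {act : ℕ → Ω → Fin A}
    {noise : ℕ → Ω → Fin D → ℝ} {t : ℕ} (h : ∀ s < t, Measurable (act s))
    (h' : ∀ s < t, Measurable (noise s)) (a : Fin A) (j : Fin D) (n : ℕ) (l : ℝ) :
    Measurable fun ω => expExponent (fun s => act s ω) (fun s => noise s ω) a j n l t := by
  simp only [expExponent, Finset.sum_filter]
  refine Finset.measurable_sum _ fun s hs => ?_
  have hs := mem_range.1 hs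
  refine Measurable.ite (MeasurableSet.inter (h s hs (measurableSet_singleton a)) ?_) ?_
    measurable_const
  · exact measurableSet_lt (measurable_pulls (fun u hu => h u (hu.trans hs)) a) measurable_const
  · exact (((measurable_pi_apply j).comp (h' s hs)).const_mul l).sub_const _

variable {A D : ℕ} {Ω : Type*}

theorem measurable_past (act : ℕ → Ω → Fin A) (noise : ℕ → Ω → Fin D → ℝ) {s t : ℕ} (h : s < t) :
    Measurable[past act noise t] fun ω => (act s ω, noise s ω) := by
  rw [measurable_iff_comap_le]
  exact le_iSup₂_of_le s h le_rfl

variable [NeZero A] [mΩ : MeasurableSpace Ω] {P : Measure Ω}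
  {μ : Fin A → Fin D → ℝ} {ν : Fin A → Measure (Fin D → ℝ)} {m : Fin D → ℝ}
  {act : ℕ → Ω → Fin A} {noise : ℕ → Ω → Fin D → ℝ}

theorem IsRunOMLEX.past_le (hrun : IsRunOMLEX P μ ν m act noise) (t : ℕ) :
    past act noise t ≤ mΩ :=
  iSup₂_le fun s _ => measurable_iff_comap_le.1
    ((hrun.measurable_act s).prodMk (hrun.measurable_noise s))

/-- The event that the noise in objective `j` of the first `n` rewards of arm `a` deviates by `l`
from its mean in the direction of the sign of `l`. -/
def deviation (act : ℕ → Ω → Fin A) (noise : ℕ → Ω → Fin D → ℝ) (T : ℕ) (a : Fin A) (j : Fin D)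
    (n : ℕ) (l : ℝ) : Set Ω :=
  {ω | n * l ^ 2 / 2 ≤ expExponent (fun s => act s ω) (fun s => noise s ω) a j n l T}

theorem IsRunOMLEX.measurableSet_deviation (hrun : IsRunOMLEX P μ ν m act noise) (T : ℕ)
    (a : Fin A) (j : Fin D) (n : ℕ) (l : ℝ) :
    MeasurableSet (deviation act noise T a j n l) :=
  measurableSet_le measurable_const (measurable_expExponent (fun s _ => hrun.measurable_act s)
    (fun s _ => hrun.measurable_noise s) a j n l)

variable [IsProbabilityMeasure P]

theorem IsRunOMLEX.ae_mem_choices (hrun : IsRunOMLEX P μ ν m act noise) :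
    ∀ᵐ ω ∂P, ∀ t, act t ω ∈ choices m (fun s => act s ω) (reward μ act noise ω) t := by
  rw [ae_all_iff]
  intro t
  have key : ∀ b : Fin A, ∀ᵐ ω ∂P, act t ω = b →
      b ∈ choices m (fun s => act s ω) (reward μ act noise ω) t := by
    intro b
    have hle := hrun.past_le t
    have hms : MeasurableSet (act t ⁻¹' {b}) := hrun.measurable_act t (measurableSet_singleton b)
    -- The zero set of `f` is measurable with respect to the past by construction, so no
    -- measurability of `choices` has to be shown.
    set f := P⟦act t ⁻¹' {b} | past act noise t⟧ with hf
    have hF : MeasurableSet[past act noise t] (f ⁻¹' {0}) :=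
      stronglyMeasurable_condExp.measurable (measurableSet_singleton 0)
    have h1 : ∫ ω in f ⁻¹' {0}, f ω ∂P = ∫ ω in f ⁻¹' {0}, (act t ⁻¹' {b}).indicator 1 ω ∂P :=
      setIntegral_condExp hle ((integrable_const (1 : ℝ)).indicator hms) hF
    have h2 : ∫ ω in f ⁻¹' {0}, f ω ∂P = 0 := by
      rw [setIntegral_congr_fun (g := fun _ => 0) (hle _ hF) fun ω hω => hω]
      simp
    rw [h2, integral_indicator_one hms, measureReal_restrict_apply hms, eq_comm,
      measureReal_eq_zero_iff] at h1
    have h3 : ∀ᵐ ω ∂P, ω ∉ act t ⁻¹' {b} ∩ f ⁻¹' {0} := measure_eq_zero_iff_ae_notMem.1 h1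
    filter_upwards [h3, hrun.act_law t b] with ω hω hlaw hb
    by_contra hcon
    refine hω ⟨hb, ?_⟩
    rw [if_neg hcon] at hlaw
    exact hlaw
  filter_upwards [ae_all_iff.2 key] with ω hω
  exact hω _ rfl

variable [∀ a, IsProbabilityMeasure (ν a)]

/-- Given that arm `a` is selected, the noise is independent of the past and has law `ν a`. -/
theorem IsRunOMLEX.setLIntegral_mul (hrun : IsRunOMLEX P μ ν m act noise) (t : ℕ) (a : Fin A)
    {W : Ω → ℝ≥0∞} (hW : Measurable[past act noise t] W) {g : (Fin D → ℝ) → ℝ≥0∞}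
    (hg : Measurable g) :
    ∫⁻ ω in act t ⁻¹' {a}, W ω * g (noise t ω) ∂P =
      (∫⁻ ω in act t ⁻¹' {a}, W ω ∂P) * ∫⁻ x, g x ∂(ν a) := by
  have hle := hrun.past_le t
  have hW' : Measurable W := hW.mono hle le_rfl
  have hnoise := hrun.measurable_noise t
  have hle' : past act noise t ⊔ MeasurableSpace.comap (act t) inferInstance ≤ mΩ :=
    sup_le hle (measurable_iff_comap_le.1 (hrun.measurable_act t))
  -- On the event that `a` is selected, the joint law of `W` and the noise is a product; it suffices
  -- to check rectangles, where the conditional law of the noise applies.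
  have hprod : ((P.restrict (act t ⁻¹' {a})).map W).prod (ν a) =
      (P.restrict (act t ⁻¹' {a})).map fun ω => (W ω, noise t ω) := by
    refine Measure.prod_eq fun s C hs hC => ?_
    rw [Measure.map_apply (hW'.prodMk hnoise) (hs.prod hC), Measure.map_apply hW' hs,
      Measure.restrict_apply (hW' hs),
      Measure.restrict_apply ((hW'.prodMk hnoise) (hs.prod hC))]
    have hset : (fun ω => (W ω, noise t ω)) ⁻¹' s ×ˢ C ∩ act t ⁻¹' {a} =
        noise t ⁻¹' C ∩ (W ⁻¹' s ∩ act t ⁻¹' {a}) := by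
      ext ω
      simp only [Set.mem_inter_iff, Set.mem_preimage, Set.mem_prod]
      tauto
    have hF : MeasurableSet[past act noise t ⊔ MeasurableSpace.comap (act t) inferInstance]
        (W ⁻¹' s ∩ act t ⁻¹' {a}) := by
      refine MeasurableSet.inter ?_ ?_
      · exact (le_sup_left : past act noise t ≤ _) _ (hW hs)
      · exact (le_sup_right : MeasurableSpace.comap (act t) inferInstance ≤ _) _
          ⟨{a}, measurableSet_singleton a, rfl⟩
    have hCm : MeasurableSet (noise t ⁻¹' C) := hnoise hC
    have h1 := setIntegral_condExp hle' ((integrable_const (1 : ℝ)).indicator (μ := P) hCm) hF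
    rw [setIntegral_congr_ae (g := fun _ => (ν a).real C) (hle' _ hF)
      ((hrun.noise_law t C hC).mono fun ω hω hωF =>
        hω.trans (congrArg (fun b => (ν b).real C) hωF.2)),
      setIntegral_const, smul_eq_mul] at h1
    have h2 : ∫ ω in W ⁻¹' s ∩ act t ⁻¹' {a}, (noise t ⁻¹' C).indicator (fun _ => (1 : ℝ)) ω ∂P
        = P.real (noise t ⁻¹' C ∩ (W ⁻¹' s ∩ act t ⁻¹' {a})) := by
      rw [← measureReal_restrict_apply hCm]
      exact integral_indicator_one hCm
    rw [h2] at h1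
    rw [hset, ← ENNReal.toReal_eq_toReal_iff' (by finiteness) (by finiteness), ENNReal.toReal_mul]
    exact h1.symm
  have hg' : Measurable fun z : ℝ≥0∞ × (Fin D → ℝ) => z.1 * g z.2 :=
    measurable_fst.mul (hg.comp measurable_snd)
  calc ∫⁻ ω in act t ⁻¹' {a}, W ω * g (noise t ω) ∂P
      = ∫⁻ z, z.1 * g z.2 ∂((P.restrict (act t ⁻¹' {a})).map fun ω => (W ω, noise t ω)) :=
        (lintegral_map hg' (hW'.prodMk hnoise)).symm
    _ = (∫⁻ ω in act t ⁻¹' {a}, W ω ∂P) * ∫⁻ x, g x ∂(ν a) := by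
        rw [← hprod, lintegral_prod_mul (f := fun y => y) measurable_id.aemeasurable
          hg.aemeasurable, lintegral_map (f := fun y => y) measurable_id hW']

theorem lintegral_exp_le_one {X : (Fin D → ℝ) → ℝ} {Q : Measure (Fin D → ℝ)}
    (h : HasSubgaussianMGF X 1 Q) (l : ℝ) :
    ∫⁻ x, ENNReal.ofReal (Real.exp (l * X x - l ^ 2 / 2)) ∂Q ≤ 1 := by
  have hint : Integrable (fun x => Real.exp (l * X x - l ^ 2 / 2)) Q := by
    simp only [Real.exp_sub]
    exact (h.integrable_exp_mul l).div_const _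
  rw [← ofReal_integral_eq_lintegral_ofReal hint (.of_forall fun _ => (Real.exp_pos _).le),
    ← ENNReal.ofReal_one]
  refine ENNReal.ofReal_le_ofReal ?_
  simp only [Real.exp_sub, integral_div]
  rw [div_le_one (Real.exp_pos _)]
  simpa [mgf] using h.mgf_le l

/-- This is the supermartingale property: one round multiplies the exponential either by 1 or, if
`a` is pulled with fewer than `n` earlier pulls, by a factor whose conditional mean is at most 1 by
sub-Gaussianity. -/
theorem IsRunOMLEX.lintegral_exp_expExponent_le_one (hrun : IsRunOMLEX P μ ν m act noise)
    (hsub : ∀ a j, HasSubgaussianMGF (fun x : Fin D → ℝ => x j) 1 (ν a)) (a : Fin A) (j : Fin D)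
    (n : ℕ) (l : ℝ) (t : ℕ) :
    ∫⁻ ω, ENNReal.ofReal (Real.exp
      (expExponent (fun s => act s ω) (fun s => noise s ω) a j n l t)) ∂P ≤ 1 := by
  induction t with
  | zero => simp [expExponent]
  | succ t ih =>
    refine le_trans ?_ ih
    set Y : Ω → ℝ≥0∞ := fun ω => ENNReal.ofReal (Real.exp
      (expExponent (fun s => act s ω) (fun s => noise s ω) a j n l t)) with hY
    set E : Set Ω := {ω | pulls (fun s => act s ω) a t < n} with hE
    have hact : ∀ s < t, Measurable[past act noise t] (act s) := fun s hs =>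
      measurable_fst.comp (measurable_past act noise hs)
    have hnoise : ∀ s < t, Measurable[past act noise t] (noise s) := fun s hs =>
      measurable_snd.comp (measurable_past act noise hs)
    have hYm : Measurable[past act noise t] Y :=
      (Real.measurable_exp.comp (@measurable_expExponent A D Ω (past act noise t) act noise t
        hact hnoise a j n l)).ennreal_ofReal
    have hEm : MeasurableSet[past act noise t] E :=
      @measurable_pulls A Ω (past act noise t) act t hact a _ measurableSet_Iio
    have hB : MeasurableSet (act t ⁻¹' {a}) := hrun.measurable_act t (measurableSet_singleton a)
    have hE' : MeasurableSet E := hrun.past_le t _ hEm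
    have hY' : Measurable Y := hYm.mono (hrun.past_le t) le_rfl
    have hg : Measurable fun x : Fin D → ℝ => ENNReal.ofReal (Real.exp (l * x j - l ^ 2 / 2)) :=
      by fun_prop
    rw [← lintegral_add_compl _ hB, ← lintegral_add_compl Y hB]
    refine add_le_add ?_ (le_of_eq ?_)
    -- Whether the quota of `n` pulls is exhausted is decided by the past, so on `E` the new noise
    -- factor has a past-measurable weight.
    · have hsplit : ∀ ω ∈ act t ⁻¹' {a}, ENNReal.ofReal (Real.exp (expExponent
          (fun s => act s ω) (fun s => noise s ω) a j n l (t + 1))) =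
          E.indicator Y ω * ENNReal.ofReal (Real.exp (l * noise t ω j - l ^ 2 / 2)) +
            Eᶜ.indicator Y ω := by
        intro ω hω
        rw [expExponent_succ]
        by_cases hn : ω ∈ E
        · rw [if_pos ⟨hω, hn⟩, Real.exp_add, ENNReal.ofReal_mul (Real.exp_pos _).le,
            Set.indicator_of_mem hn, Set.indicator_of_notMem (Set.notMem_compl_iff.2 hn), add_zero]
        · rw [if_neg fun h => hn h.2, Set.indicator_of_notMem hn,
            Set.indicator_of_mem (Set.mem_compl hn), add_zero, zero_mul, zero_add]
      rw [setLIntegral_congr_fun hB hsplit,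
        lintegral_add_right _ (hY'.indicator hE'.compl),
        hrun.setLIntegral_mul t a (hYm.indicator hEm) hg]
      calc _ ≤ (∫⁻ ω in act t ⁻¹' {a}, E.indicator Y ω ∂P) * 1 +
            ∫⁻ ω in act t ⁻¹' {a}, Eᶜ.indicator Y ω ∂P := by
            gcongr
            exact lintegral_exp_le_one (hsub a j) l
        _ = ∫⁻ ω in act t ⁻¹' {a}, Y ω ∂P := by
            rw [mul_one, ← lintegral_add_right _ (hY'.indicator hE'.compl)]
            congr 1
            ext ω
            exact congrFun (Set.indicator_self_add_compl E Y) ω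
    · refine setLIntegral_congr_fun hB.compl fun ω hω => ?_
      simp only [hY]
      rw [expExponent_succ, if_neg fun h => hω h.1, add_zero]

/-- Markov's inequality for the exponential, whose mean is at most 1. -/
theorem IsRunOMLEX.measureReal_deviation_le (hrun : IsRunOMLEX P μ ν m act noise)
    (hsub : ∀ a j, HasSubgaussianMGF (fun x : Fin D → ℝ => x j) 1 (ν a)) (T : ℕ)
    (a : Fin A) (j : Fin D) (n : ℕ) (l : ℝ) :
    P.real (deviation act noise T a j n l) ≤ Real.exp (-(n * l ^ 2 / 2)) := by
  have hm : Measurable fun ω => ENNReal.ofReal (Real.exp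
      (expExponent (fun s => act s ω) (fun s => noise s ω) a j n l T)) :=
    (Real.measurable_exp.comp (measurable_expExponent (fun s _ => hrun.measurable_act s)
      (fun s _ => hrun.measurable_noise s) a j n l)).ennreal_ofReal
  have h1 := (mul_meas_ge_le_lintegral₀ hm.aemeasurable
    (ENNReal.ofReal (Real.exp (n * l ^ 2 / 2)))).trans
      (hrun.lintegral_exp_expExponent_le_one hsub a j n l T)
  have hset : {ω | ENNReal.ofReal (Real.exp (n * l ^ 2 / 2)) ≤ ENNReal.ofReal (Real.exp
      (expExponent (fun s => act s ω) (fun s => noise s ω) a j n l T))} =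
      deviation act noise T a j n l := by
    ext ω
    simp only [Set.mem_ofPred_eq, deviation]
    rw [ENNReal.ofReal_le_ofReal_iff (Real.exp_pos _).le, Real.exp_le_exp]
  rw [hset] at h1
  have h2 := ENNReal.toReal_mono ENNReal.one_ne_top h1
  rw [ENNReal.toReal_mul, ENNReal.toReal_ofReal (Real.exp_pos _).le, ENNReal.toReal_one] at h2
  rw [Real.exp_neg, ← one_div, le_div_iff₀' (Real.exp_pos _)]
  exact h2

end Probability

/-! ### Numerical estimates behind the constants 36 and 17 -/

section Estimates

/-- Apply `log y ≤ y - 1` to `y = n d ^ 2 / 18`. This bounds `log n` by `n d ^ 2 / 18 + log (18 / d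
^ 2)`, and the last term is at most `2 log (17 / d) ≤ n d ^ 2 / 18` since `18 ≤ 17 ^ 2`. -/
theorem nine_mul_log_le {d n : ℝ} (hd : 0 < d) (hn : 0 < n)
    (h : 36 * Real.log (17 / d) ≤ n * d ^ 2) : 9 * Real.log n ≤ n * d ^ 2 := by
  have h1 := Real.log_le_sub_one_of_pos (show 0 < n * d ^ 2 / 18 by positivity)
  rw [Real.log_div (by positivity) (by norm_num), Real.log_mul hn.ne' (by positivity),
    Real.log_pow] at h1
  rw [Real.log_div (by norm_num) hd.ne'] at h
  have h2 : Real.log 18 ≤ 2 * Real.log 17 := by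
    rw [← Real.log_rpow (by norm_num)]
    exact Real.log_le_log (by norm_num) (by norm_num)
  push_cast at h1
  linarith

theorem sum_exp_Ico_le_one {d : ℝ} (hd : 0 < d) {K : ℕ}
    (hK : 36 * Real.log (17 / d) ≤ (K + 1) * d ^ 2) (T : ℕ) :
    ∑ n ∈ Ico (K + 1) T, Real.exp (-(n * d ^ 2 / 18)) ≤ 1 := by
  obtain ⟨x, hx⟩ : ∃ x, x = d ^ 2 / 18 := ⟨_, rfl⟩
  have hx0 : 0 < x := by rw [hx]; positivity
  have hq : Real.exp (-x) ≤ 1 / (1 + x) := by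
    rw [Real.exp_neg, ← one_div]
    exact one_div_le_one_div_of_le (by positivity) (by linarith [Real.add_one_le_exp x])
  have hq1 : Real.exp (-x) < 1 := by simpa using hx0
  have hpow : ∀ n : ℕ, Real.exp (-(n * d ^ 2 / 18)) = Real.exp (-x) ^ n := fun n => by
    rw [← Real.exp_nat_mul, hx]
    congr 1
    ring
  simp only [hpow]
  refine (geom_sum_Ico_le_of_lt_one (Real.exp_pos _).le hq1).trans ?_
  rw [div_le_one (by linarith)]
  -- With `q = exp (-x)` the claim is `q ^ (K + 1) ≤ 1 - q`. For `x ≥ 1` already `q ≤ 1 / 2`; for `x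
  -- < 1` the hypothesis on `K` gives `q ^ (K + 1) ≤ d ^ 2 / 289 = 18 x / 289`, while `1 - q ≥ x /
  -- 2`.
  obtain h | h := le_or_gt 1 x
  · have h1 : Real.exp (-x) ^ (K + 1) ≤ Real.exp (-x) :=
      pow_le_of_le_one (Real.exp_pos _).le hq1.le K.succ_ne_zero
    have h2 : 1 / (1 + x) ≤ 1 / 2 := one_div_le_one_div_of_le (by norm_num) (by linarith)
    linarith
  · have h1 : Real.exp (-x) ^ (K + 1) ≤ 18 * x / 289 := by
      rw [← Real.exp_nat_mul, show 18 * x / 289 = Real.exp (-(2 * Real.log (17 / d))) by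
        rw [Real.exp_neg, two_mul, Real.exp_add, Real.exp_log (by positivity), hx]
        field_simp
        norm_num]
      refine Real.exp_le_exp.2 ?_
      push_cast
      rw [hx]
      linarith
    have h2 : 1 / (1 + x) ≤ 1 - x / 2 := by
      rw [div_le_iff₀ (by positivity)]
      nlinarith
    linarith

theorem sum_Ico_two_le (T : ℕ) :
    ∑ n ∈ Ico 2 T, 1 / (n : ℝ) ^ 2 ≤ Real.pi ^ 2 / 6 - 1 := by
  have h := sum_le_hasSum (insert 1 (Ico 2 T)) (fun n _ => by positivity) hasSum_zeta_two
  rw [Finset.sum_insert (by simp)] at h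
  norm_num at h ⊢
  linarith

end Estimates

/-! ### From confidence tests to deviation events -/

section Deviation

variable {A D : ℕ} {x : ℕ → Fin A} {μ : Fin A → Fin D → ℝ} {v : ℕ → Fin D → ℝ} {t T : ℕ}

/-- Using the deviation `l` itself as the parameter is optimal: a noise sum of size `n l` in the
direction of `l` makes the exponent at least `n l ^ 2 - n l ^ 2 / 2`. -/
theorem le_expExponent_of_le {a : Fin A} {j : Fin D} {l : ℝ} (hT : t ≤ T)
    (h : pulls x a t * l ^ 2 ≤ l * (∑ s ∈ range t with x s = a, v s j)) :
    pulls x a t * l ^ 2 / 2 ≤ expExponent x v a j (pulls x a t) l T := by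
  rw [expExponent_pulls x v a j l hT]
  linarith

theorem exists_le_expExponent_of_notMem {b : Fin A} (hT : t ≤ T) (hp : 0 < pulls x b t)
    (hb : b ∉ estimatedOptimal (μ b) x (fun s i => μ (x s) i + v s i) t) :
    ∃ j, ∃ l, (l = Real.sqrt (4 * Real.log (pulls x b t) / pulls x b t) ∨
        l = -Real.sqrt (4 * Real.log (pulls x b t) / pulls x b t)) ∧
      pulls x b t * l ^ 2 / 2 ≤ expExponent x v b j (pulls x b t) l T := by
  simp only [estimatedOptimal, mem_filter, mem_univ, true_and, not_forall, not_lt] at hb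
  obtain ⟨j, hj⟩ := hb
  rw [sampleMean_add x μ v b j hp, add_sub_cancel_left] at hj
  have hp' : (0 : ℝ) < pulls x b t := by exact_mod_cast hp
  set ε := Real.sqrt (4 * Real.log (pulls x b t) / pulls x b t)
  have hε : 0 ≤ ε := Real.sqrt_nonneg _
  refine ⟨j, ?_⟩
  obtain h | h := le_abs.1 hj
  · refine ⟨ε, .inl rfl, le_expExponent_of_le hT ?_⟩
    rw [le_div_iff₀ hp'] at h
    nlinarith [mul_le_mul_of_nonneg_left h hε]
  · refine ⟨-ε, .inr rfl, le_expExponent_of_le hT ?_⟩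
    rw [← neg_div, le_div_iff₀ hp'] at h
    nlinarith [mul_le_mul_of_nonneg_left h hε]

/-- With no pulls the radius evaluates to `√(0 / 0) = 0`, and the strict inequality fails in
objective `j`. -/
theorem pulls_pos_of_mem_estimatedOptimal {m : Fin D → ℝ} {r : ℕ → Fin D → ℝ} {a : Fin A}
    (j : Fin D) (ha : a ∈ estimatedOptimal m x r t) : 0 < pulls x a t := by
  simp only [estimatedOptimal, mem_filter, mem_univ, true_and] at ha
  refine Nat.pos_of_ne_zero fun h0 => (abs_nonneg _).not_gt ((ha j).trans_eq ?_)
  simp [h0]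

theorem le_expExponent_of_mem {m : Fin D → ℝ} {a : Fin A} {j : Fin D} (hT : t ≤ T)
    (hd : m j - μ a j ≠ 0)
    (hlog : 36 * Real.log (17 / |m j - μ a j|) ≤ pulls x a t * |m j - μ a j| ^ 2)
    (ha : a ∈ estimatedOptimal m x (fun s i => μ (x s) i + v s i) t) :
    pulls x a t * ((m j - μ a j) / 3) ^ 2 / 2 ≤
      expExponent x v a j (pulls x a t) ((m j - μ a j) / 3) T := by
  have hp := pulls_pos_of_mem_estimatedOptimal j ha
  have hp' : (0 : ℝ) < pulls x a t := by exact_mod_cast hp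
  simp only [estimatedOptimal, mem_filter, mem_univ, true_and] at ha
  have hj := ha j
  rw [sampleMean_add x μ v a j hp] at hj
  set δ := m j - μ a j with hδ
  have h9 := nine_mul_log_le (abs_pos.2 hd) hp' hlog
  have hr : Real.sqrt (4 * Real.log (pulls x a t) / pulls x a t) ≤ 2 / 3 * |δ| := by
    refine Real.sqrt_le_iff.2 ⟨by positivity, ?_⟩
    rw [div_le_iff₀ hp']
    linarith
  have hlt := hj.trans_le hr
  refine le_expExponent_of_le hT ?_
  set z := (∑ s ∈ range t with x s = a, v s j) / pulls x a t with hz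
  have hS : ∑ s ∈ range t with x s = a, v s j = z * pulls x a t := by
    rw [hz, div_mul_cancel₀ _ hp'.ne']
  rw [hS]
  have hzδ : |z - δ| < 2 / 3 * |δ| := by
    rwa [show z - δ = μ a j + z - m j by rw [hδ]; ring]
  -- Lying within `2 / 3 * |δ|` of `δ`, the noise mean `z` has the sign of `δ` and size at least
  -- `|δ| / 3`.
  have hmain : δ * δ ≤ 3 * (δ * z) := by
    obtain h | h := abs_cases δ <;> rw [h.1, abs_lt] at hzδ <;> nlinarith
  nlinarith [mul_le_mul_of_nonneg_left hmain hp'.le]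

end Deviation

/-! ### Expected number of pulls and regret -/

section Main

variable {A D : ℕ} {μ : Fin A → Fin D → ℝ} {star : Fin A}

theorem regretPF_le (x : ℕ → Fin A) (i : Fin D) (T : ℕ) :
    regretPF μ star i x T ≤ ∑ a ∈ suboptimal μ star i, gap μ star a i * pulls x a T := by
  have h : regretPF μ star i x T = ∑ a, gap μ star a i * pulls x a T := by
    rw [regretPF, ← Finset.sum_fiberwise (range T) x]
    refine Finset.sum_congr rfl fun a _ => ?_
    rw [Finset.sum_congr rfl (g := fun _ => gap μ star a i) fun s hs => by rw [(mem_filter.1 hs).2],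
      Finset.sum_const, nsmul_eq_mul, pulls, mul_comm]
  rw [h, ← Finset.sum_filter_add_sum_filter_not univ (fun a => 0 < gap μ star a i)]
  refine add_le_of_le_of_nonpos (le_of_eq ?_) (Finset.sum_nonpos fun a ha => ?_)
  · congr 1
  · exact mul_nonpos_of_nonpos_of_nonneg (not_lt.1 (mem_filter.1 ha).2) (Nat.cast_nonneg _)

variable [NeZero A] {Ω : Type*} {act : ℕ → Ω → Fin A} {noise : ℕ → Ω → Fin D → ℝ}

open Classical in
/-- The number of pulls of an arm is bounded by the number of deviations that occur. -/
theorem pulls_le_sum_indicator {ω : Ω} {T : ℕ} (hω : ∀ t,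
      act t ω ∈ choices (μ star) (fun s => act s ω) (reward μ act noise ω) t)
    (a : Fin A) (j : Fin D) (hd : gap μ star a j ≠ 0) {K : ℕ}
    (hK : 36 * Real.log (17 / |gap μ star a j|) ≤ (K + 1) * |gap μ star a j| ^ 2) :
    (pulls (fun s => act s ω) a T : ℝ) ≤ 2 + K +
      ∑ n ∈ Ico 2 T, ∑ k : Fin D,
        ((deviation act noise T star k n (Real.sqrt (4 * Real.log n / n))).indicator 1 ω +
          (deviation act noise T star k n (-Real.sqrt (4 * Real.log n / n))).indicator 1 ω) +
      ∑ n ∈ Ico (K + 1) T,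
        (deviation act noise T a j n (gap μ star a j / 3)).indicator 1 ω := by
  set ε : ℕ → ℝ := fun n => Real.sqrt (4 * Real.log n / n)
  set U : Finset ℕ := {n ∈ Ico 2 T | ∃ k, ω ∈ deviation act noise T star k n (ε n) ∨
    ω ∈ deviation act noise T star k n (-ε n)} with hU
  set V : Finset ℕ := {n ∈ Ico (K + 1) T | ω ∈ deviation act noise T a j n (gap μ star a j / 3)}
    with hV
  have hS : ∀ t < T, 0 < pulls (fun s => act s ω) star t →
      star ∉ estimatedOptimal (μ star) (fun s => act s ω) (reward μ act noise ω) t →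
      pulls (fun s => act s ω) star t ∈ insert 1 U := by
    intro t ht hp hb
    -- Pull count 1 is set apart: there the radius is `√(4 log 1) = 0` and the tail bound is
    -- trivial.
    obtain h1 | h1 := Nat.eq_or_lt_of_le hp
    · rw [← h1]
      exact mem_insert_self _ _
    · obtain ⟨k, l, hl, h⟩ := exists_le_expExponent_of_notMem
        (v := fun s => noise s ω) ht.le hp hb
      refine mem_insert_of_mem (mem_filter.2
        ⟨mem_Ico.2 ⟨h1, (pulls_le _ _ _).trans_lt ht⟩, k, ?_⟩)
      obtain rfl | rfl := hl
      · exact .inl h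
      · exact .inr h
  have hS' : ∀ t < T,
      a ∈ estimatedOptimal (μ star) (fun s => act s ω) (reward μ act noise ω) t →
      pulls (fun s => act s ω) a t ∈ Ico 1 (K + 1) ∪ V := by
    intro t ht ha
    have hp := pulls_pos_of_mem_estimatedOptimal j ha
    obtain h1 | h1 := lt_or_ge (pulls (fun s => act s ω) a t) (K + 1)
    · exact mem_union_left _ (mem_Ico.2 ⟨hp, h1⟩)
    · refine mem_union_right _ (mem_filter.2
        ⟨mem_Ico.2 ⟨h1, (pulls_le _ _ _).trans_lt ht⟩, ?_⟩)
      refine le_expExponent_of_mem (v := fun s => noise s ω) ht.le hd (hK.trans ?_) ha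
      have : ((K : ℝ) + 1) ≤ pulls (fun s => act s ω) a t := by exact_mod_cast h1
      exact mul_le_mul_of_nonneg_right this (sq_nonneg _)
  have hcount := pulls_le_card_add_card (T := T) (fun t _ => hω t) a star _ _ hS hS'
  -- The 2 stands for the initial pass and for the pull count 1 of `star`; `K` counts the early
  -- exploitations of `a`.
  have hcard : pulls (fun s => act s ω) a T ≤ 2 + K + #U + #V := by
    have h1 := Finset.card_insert_le 1 U
    have h2 := Finset.card_union_le (Ico 1 (K + 1)) V
    rw [Nat.card_Ico] at h2
    omega
  have hUle : (#U : ℝ) ≤ ∑ n ∈ Ico 2 T, ∑ k : Fin D,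
      ((deviation act noise T star k n (ε n)).indicator 1 ω +
        (deviation act noise T star k n (-ε n)).indicator 1 ω) := by
    rw [hU, Finset.card_filter, Nat.cast_sum]
    refine Finset.sum_le_sum fun n _ => ?_
    have hnn : ∀ E : Set Ω, (0 : ℝ) ≤ E.indicator 1 ω := fun E =>
      Set.indicator_nonneg (fun _ _ => zero_le_one) ω
    split_ifs with h
    · obtain ⟨k, hk⟩ := h
      refine le_trans ?_ (Finset.single_le_sum
        (fun k _ => add_nonneg (hnn _) (hnn _)) (mem_univ k))
      obtain hk | hk := hk
      · rw [Set.indicator_of_mem hk]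
        simpa using hnn _
      · rw [Set.indicator_of_mem hk]
        simpa using hnn _
    · rw [Nat.cast_zero]
      exact Finset.sum_nonneg fun k _ => add_nonneg (hnn _) (hnn _)
  have hVle : (#V : ℝ) = ∑ n ∈ Ico (K + 1) T,
      (deviation act noise T a j n (gap μ star a j / 3)).indicator 1 ω := by
    rw [hV, Finset.card_filter, Nat.cast_sum]
    refine Finset.sum_congr rfl fun n _ => ?_
    rw [Set.indicator_apply]
    split_ifs <;> simp
  rw [← hVle]
  have : (pulls (fun s => act s ω) a T : ℝ) ≤ 2 + K + #U + #V := by exact_mod_cast hcard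
  linarith

variable [MeasurableSpace Ω] {P : Measure Ω} [IsProbabilityMeasure P]
  {ν : Fin A → Measure (Fin D → ℝ)}

theorem IsRunOMLEX.integrable_pulls (hrun : IsRunOMLEX P μ ν (μ star) act noise) (a : Fin A)
    (T : ℕ) : Integrable (fun ω => (pulls (fun s => act s ω) a T : ℝ)) P := by
  refine Integrable.of_bound (C := T) (measurable_from_top.comp
    (measurable_pulls (fun s _ => hrun.measurable_act s) a)).aestronglyMeasurable
    (.of_forall fun ω => ?_)
  rw [Real.norm_natCast]
  exact_mod_cast pulls_le _ a T

theorem IsRunOMLEX.integral_pulls_le [∀ a, IsProbabilityMeasure (ν a)]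
    (hrun : IsRunOMLEX P μ ν (μ star) act noise)
    (hsub : ∀ a j, HasSubgaussianMGF (fun x : Fin D → ℝ => x j) 1 (ν a))
    (a : Fin A) (hd : 0 < maxAbsGap μ star a) [NeZero D] (T : ℕ) :
    ∫ ω, (pulls (fun s => act s ω) a T : ℝ) ∂P ≤ Real.pi ^ 2 / 3 * D + 1 +
      36 / maxAbsGap μ star a ^ 2 * max (Real.log (17 / maxAbsGap μ star a)) 0 := by
  obtain ⟨j, hj⟩ : ∃ j, |gap μ star a j| = maxAbsGap μ star a := exists_eq_ciSup_of_finite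
  set d := maxAbsGap μ star a
  set B : ℝ := 36 / d ^ 2 * max (Real.log (17 / d)) 0 with hB
  have hB0 : 0 ≤ B := by positivity
  -- The threshold is `K = ⌊B⌋`, so that `K + 1 > B` meets the logarithmic condition while `K ≤ B`
  -- enters the bound.
  have hKd : 36 * Real.log (17 / d) ≤ (⌊B⌋₊ + 1) * d ^ 2 := by
    have h1 : B * d ^ 2 = 36 * max (Real.log (17 / d)) 0 := by
      rw [hB]
      field_simp
    have h2 := mul_le_mul_of_nonneg_right (Nat.lt_floor_add_one B).le (sq_nonneg d)
    linarith [le_max_left (Real.log (17 / d)) 0]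
  have hint : ∀ (b : Fin A) (k : Fin D) (n : ℕ) (l : ℝ), Integrable
      ((deviation act noise T b k n l).indicator (1 : Ω → ℝ)) P := fun b k n l =>
    (integrable_const 1).indicator (hrun.measurableSet_deviation T b k n l)
  have hval : ∀ (b : Fin A) (k : Fin D) (n : ℕ) (l : ℝ),
      ∫ ω, (deviation act noise T b k n l).indicator (1 : Ω → ℝ) ω ∂P ≤
        Real.exp (-(n * l ^ 2 / 2)) := fun b k n l => by
    rw [integral_indicator_one (hrun.measurableSet_deviation T b k n l)]
    exact hrun.measureReal_deviation_le hsub T b k n l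
  have hsum1 : ∀ n ∈ Ico 2 T, ∀ l : ℝ, l ^ 2 = 4 * Real.log n / n → ∀ k : Fin D,
      ∫ ω, (deviation act noise T star k n l).indicator (1 : Ω → ℝ) ω ∂P ≤ 1 / (n : ℝ) ^ 2 := by
    intro n hn l hl k
    have hn0 : (0 : ℝ) < n := by
      have := (mem_Ico.1 hn).1
      exact_mod_cast (by omega : 0 < n)
    refine (hval star k n l).trans (le_of_eq ?_)
    rw [hl, show (n : ℝ) * (4 * Real.log n / n) / 2 = 2 * Real.log n by field_simp; ring,
      Real.exp_neg, two_mul, Real.exp_add, Real.exp_log hn0, one_div, pow_two]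
  have hbound1 : ∀ n ∈ Ico 2 T, ∀ k : Fin D, Integrable (fun ω =>
      (deviation act noise T star k n (Real.sqrt (4 * Real.log n / n))).indicator (1 : Ω → ℝ) ω +
      (deviation act noise T star k n (-Real.sqrt (4 * Real.log n / n))).indicator 1 ω) P :=
    fun n _ k => (hint _ _ _ _).add (hint _ _ _ _)
  have hI1 : Integrable (fun ω => ∑ n ∈ Ico 2 T, ∑ k : Fin D,
      ((deviation act noise T star k n (Real.sqrt (4 * Real.log n / n))).indicator (1 : Ω → ℝ) ω +
      (deviation act noise T star k n (-Real.sqrt (4 * Real.log n / n))).indicator 1 ω)) P :=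
    integrable_finsetSum _ fun n hn => integrable_finsetSum _ fun k _ => hbound1 n hn k
  have hI2 : Integrable (fun ω => ∑ n ∈ Ico (⌊B⌋₊ + 1) T,
      (deviation act noise T a j n (gap μ star a j / 3)).indicator (1 : Ω → ℝ) ω) P :=
    integrable_finsetSum _ fun n _ => hint _ _ _ _
  have hE1 : ∫ ω, ∑ n ∈ Ico 2 T, ∑ k : Fin D,
      ((deviation act noise T star k n (Real.sqrt (4 * Real.log n / n))).indicator (1 : Ω → ℝ) ω +
      (deviation act noise T star k n (-Real.sqrt (4 * Real.log n / n))).indicator 1 ω) ∂P ≤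
      2 * D * (Real.pi ^ 2 / 6 - 1) := by
    rw [integral_finsetSum _ fun n hn => integrable_finsetSum _ fun k _ => hbound1 n hn k]
    refine le_trans (Finset.sum_le_sum (g := fun n : ℕ => 2 * D * (1 / (n : ℝ) ^ 2)) fun n hn => ?_)
      ?_
    · rw [integral_finsetSum _ fun k _ => hbound1 n hn k]
      refine (Finset.sum_le_card_nsmul _ _ (2 * (1 / (n : ℝ) ^ 2)) fun k _ => ?_).trans
        (le_of_eq ?_)
      · have hnn : 0 ≤ 4 * Real.log n / n := by positivity
        rw [integral_add (hint _ _ _ _) (hint _ _ _ _)]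
        have h1 := hsum1 n hn _ (Real.sq_sqrt hnn) k
        have h2 := hsum1 n hn (-Real.sqrt (4 * Real.log n / n))
          (by rw [neg_sq, Real.sq_sqrt hnn]) k
        linarith
      · rw [Finset.card_univ, Fintype.card_fin, nsmul_eq_mul]
        ring
    · rw [← Finset.mul_sum]
      exact mul_le_mul_of_nonneg_left (sum_Ico_two_le T) (by positivity)
  have hE2 : ∫ ω, ∑ n ∈ Ico (⌊B⌋₊ + 1) T,
      (deviation act noise T a j n (gap μ star a j / 3)).indicator (1 : Ω → ℝ) ω ∂P ≤ 1 := by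
    rw [integral_finsetSum _ fun n _ => hint _ _ _ _]
    refine le_trans (Finset.sum_le_sum fun n _ => ?_) (sum_exp_Ico_le_one hd hKd T)
    refine (hval _ _ _ _).trans (le_of_eq ?_)
    rw [← hj, sq_abs]
    congr 1
    ring
  -- The constants add up to `2 + 2 D (π ^ 2 / 6 - 1) + 1 = π ^ 2 / 3 * D + 3 - 2 D`, and `D ≥ 1`
  -- brings this down to `π ^ 2 / 3 * D + 1`.
  have hD : (1 : ℝ) ≤ D := by exact_mod_cast NeZero.one_le
  have hfloor := Nat.floor_le hB0
  have hle : ∀ᵐ ω ∂P, _ := hrun.ae_mem_choices.mono fun ω hω =>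
    pulls_le_sum_indicator (T := T) hω a j (abs_pos.1 (hj ▸ hd)) (hj.symm ▸ hKd)
  refine (integral_mono_ae (hrun.integrable_pulls a T)
    (((integrable_const _).add hI1).add hI2) hle).trans ?_
  rw [integral_add' ((integrable_const _).add hI1) hI2, integral_add' (integrable_const _) hI1,
    integral_const, probReal_univ, one_smul]
  nlinarith

end Main

end LexBandit

/-- Uniformly bounded expected priority-free regret of OM-LEX when the lexicographic optimal
expected rewards `μ star` are known. -/
theorem mainTheorem5 {A D : ℕ} [NeZero A] (μ : Fin A → Fin D → ℝ)
    (ν : Fin A → Measure (Fin D → ℝ)) [∀ a, IsProbabilityMeasure (ν a)]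
    (hmean : ∀ a j, ∫ x, x j ∂(ν a) = 0)
    (hsub : ∀ a j, HasSubgaussianMGF (fun x : Fin D → ℝ => x j) 1 (ν a))
    (star : Fin A) (hstar : star ∈ LexBandit.lexOptimal μ D)
    {Ω : Type*} [MeasurableSpace Ω] (P : Measure Ω) [IsProbabilityMeasure P]
    (act : ℕ → Ω → Fin A) (noise : ℕ → Ω → Fin D → ℝ)
    (hrun : LexBandit.IsRunOMLEX P μ ν (μ star) act noise)
    (i : Fin D) (T : ℕ) :
    ∫ ω, LexBandit.regretPF μ star i (fun t => act t ω) T ∂P ≤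
      ∑ a ∈ LexBandit.suboptimal μ star i,
        ((Real.pi ^ 2 / 3 * D + 1) * LexBandit.gap μ star a i +
          36 / LexBandit.maxAbsGap μ star a *
            max (Real.log (17 / LexBandit.maxAbsGap μ star a)) 0) := by
  have : NeZero D := ⟨fun h => (h ▸ i).elim0⟩
  have hint : ∀ a ∈ LexBandit.suboptimal μ star i, Integrable (fun ω =>
      LexBandit.gap μ star a i * (LexBandit.pulls (fun t => act t ω) a T : ℝ)) P :=
    fun a _ => (hrun.integrable_pulls a T).const_mul _
  have hreg : Integrable (fun ω => LexBandit.regretPF μ star i (fun t => act t ω) T) P := by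
    refine integrable_finsetSum _ fun t _ => ?_
    exact (Integrable.of_finite (f := fun b => LexBandit.gap μ star b i)).comp_measurable
      (hrun.measurable_act t)
  refine (integral_mono hreg (integrable_finsetSum _ hint)
    fun ω => LexBandit.regretPF_le (fun t => act t ω) i T).trans ?_
  rw [integral_finsetSum _ hint]
  refine Finset.sum_le_sum fun a ha => ?_
  have hgap : 0 < LexBandit.gap μ star a i := by simpa [LexBandit.suboptimal] using ha
  have hle : LexBandit.gap μ star a i ≤ LexBandit.maxAbsGap μ star a :=
    (le_abs_self _).trans (le_ciSup (f := fun j => |LexBandit.gap μ star a j|)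
      (Set.finite_range _).bddAbove i)
  have hd := hgap.trans_le hle
  rw [integral_const_mul]
  refine (mul_le_mul_of_nonneg_left (hrun.integral_pulls_le hsub a hd T) hgap.le).trans ?_
  rw [mul_add, mul_comm (LexBandit.gap μ star a i)]
  rw [← mul_assoc]
  gcongr
  -- One factor of the squared maximal gap in the denominator cancels against the gap in objective
  -- `i`, which is no larger.
  rw [mul_div_assoc', div_le_div_iff₀ (by positivity) hd]
  nlinarith [mul_le_mul_of_nonneg_right hle hd.le]
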